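/- Let $X,Y$ be $d\times d$ complex matrices with $X>0$ positive definite and $\operatorname{Tr}YY^\dagger=\operatorname{Tr}XX^\dagger$ (for example, both equal to $1$), and write $Y=W+iZ$ with $W=W^\dagger$, $Z=Z^\dagger$. Let $S(\rho)=-\operatorname{Tr}\rho\log\rho$. Then the function $t\mapsto S\big((\sqrt{1-t^2}\,X+tY)(\sqrt{1-t^2}\,X+tY)^\dagger\big)$ is twice differentiable at $t=0$, and $$D_2[X,Y]\equiv\frac{d^2}{dt^2}S\Big((\sqrt{1-t^2}\,X+tY)(\sqrt{1-t^2}\,X+tY)^\dagger\Big)\Big|_{t=0}=-2S(X^2)-2\operatorname{Tr}(W^2+Z^2)\log X^2-\widetilde Q[X,Y]$$ $$=-2S(X^2)-2\operatorname{Tr}(W^2+Z^2)\log X^2-\operatorname{Tr}W\,\phi(\Delta_X)(W)-\operatorname{Tr}Z\,\phi(-\Delta_X)(Z).$$ Here $\widetilde Q[X,Y]=Q[X,Y]-2i\operatorname{Tr}(WZ-ZW)\log X^2$ with $$Q[X,Y]=\operatorname{Tr}\,\Gamma_1\int_0^\infty\frac1{X^2+uI}\,\Gamma_1\,\frac1{X^2+uI}\,du,\qquad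 \Gamma_1=YX+XY^\dagger$$ (the integral converges absolutely); $\phi(a)=\frac{a+1}{a-1}\log a^2$ for $a\ne 0,1$, extended by continuity by $\phi(1)=4$; $\Delta_X=L_XR_X^{-1}$, i.e. $\Delta_X(A)=XAX^{-1}$, is the modular operator on $d\times d$ matrices; and $\phi(\pm\Delta_X)$ is defined by the functional calculus for operators that are self-adjoint with respect to the Hilbert-Schmidt inner product. -/

import Mathlib

open scoped Matrix ComplexOrder

noncomputable section

namespace EntropyDeriv

variable {n : Type*} [Fintype n] [DecidableEq n]

/-- The logarithm of a Hermitian matrix, by the functional calculus. -/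
def matLog (A : Matrix n n ℂ) : Matrix n n ℂ := cfc Real.log A

/-- The entropy `S(ρ) = - Tr ρ log ρ` of a positive semi-definite matrix (with `0 log 0 = 0`);
the trace is real for Hermitian `ρ`, see `ofReal_entropy`. -/
def entropy (ρ : Matrix n n ℂ) : ℝ := -((ρ * matLog ρ).trace).re

theorem matLog_isHermitian (A : Matrix n n ℂ) : (matLog A).IsHermitian :=
  cfc_predicate (R := ℝ) (p := IsSelfAdjoint) Real.log A

theorem ofReal_entropy {ρ : Matrix n n ℂ} (hρ : ρ.IsHermitian) :
    ((entropy ρ : ℝ) : ℂ) = -(ρ * matLog ρ).trace := by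
  have h : star (ρ * matLog ρ).trace = (ρ * matLog ρ).trace := by
    rw [← Matrix.trace_conjTranspose, Matrix.conjTranspose_mul, hρ.eq,
      (matLog_isHermitian ρ).eq, Matrix.trace_mul_comm]
  have h2 : (((ρ * matLog ρ).trace.re : ℝ) : ℂ) = (ρ * matLog ρ).trace :=
    Complex.conj_eq_iff_re.mp h
  simp [entropy, h2]

/-- The curve `X(t) = √(1 - t²) X + t Y`. -/
def curve (X Y : Matrix n n ℂ) (t : ℝ) : Matrix n n ℂ :=
  ((√(1 - t ^ 2) : ℝ) : ℂ) • X + (t : ℂ) • Y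

/-- The function `t ↦ S(X(t) X(t)†)`. -/
def curveEntropy (X Y : Matrix n n ℂ) (t : ℝ) : ℝ :=
  entropy (curve X Y t * (curve X Y t)ᴴ)

/-- `D₂[X, Y]`, the second derivative of `t ↦ S(X(t) X(t)†)` at `t = 0`. -/
def D2 (X Y : Matrix n n ℂ) : ℝ := deriv (deriv (curveEntropy X Y)) 0

/-- The modular operator `Δ_X = L_X R_X⁻¹` on matrices, for invertible `X`;
here `R_X⁻¹` is right multiplication by `X⁻¹`. -/
def modularOp (X : Matrix n n ℂ) : Matrix n n ℂ →ₗ[ℂ] Matrix n n ℂ :=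
  LinearMap.mulLeft ℂ X ∘ₗ LinearMap.mulRight ℂ X⁻¹

/-- The functional calculus `f(T)` for a linear map `T` on matrices that is self-adjoint for the
Hilbert-Schmidt inner product. The matrix units are an orthonormal basis for that inner product,
so `T` is self-adjoint exactly when its matrix in this basis is Hermitian, and `f(T)` is the map
whose matrix is `f` of the matrix of `T`. -/
def superCfc (f : ℝ → ℝ) (T : Matrix n n ℂ →ₗ[ℂ] Matrix n n ℂ) :
    Matrix n n ℂ →ₗ[ℂ] Matrix n n ℂ :=
  Matrix.toLin (Matrix.stdBasis ℂ n n) (Matrix.stdBasis ℂ n n)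
    (cfc f (LinearMap.toMatrix (Matrix.stdBasis ℂ n n) (Matrix.stdBasis ℂ n n) T))

/-- `φ(a) = (a + 1) / (a - 1) * log a²`, extended by continuity by `φ(1) = 4`. -/
def phi (a : ℝ) : ℝ := if a = 1 then 4 else (a + 1) / (a - 1) * Real.log (a ^ 2)

/-- `Γ₁ = Y X + X Y†`. -/
def gammaOne (X Y : Matrix n n ℂ) : Matrix n n ℂ := Y * X + X * Yᴴ

/-- The integrand `(X² + u I)⁻¹ Γ₁ (X² + u I)⁻¹`. -/
def resolventIntegrand (X Y : Matrix n n ℂ) (u : ℝ) : Matrix n n ℂ :=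
  (X ^ 2 + (u : ℂ) • (1 : Matrix n n ℂ))⁻¹ * gammaOne X Y *
    (X ^ 2 + (u : ℂ) • (1 : Matrix n n ℂ))⁻¹

/-- `∫₀^∞ (X² + u I)⁻¹ Γ₁ (X² + u I)⁻¹ du`, the integral being taken entry by entry. -/
def resolventIntegral (X Y : Matrix n n ℂ) : Matrix n n ℂ :=
  Matrix.of fun i j => ∫ u in Set.Ioi (0 : ℝ), resolventIntegrand X Y u i j

/-- `Q[X, Y] = Tr Γ₁ ∫₀^∞ (X² + u I)⁻¹ Γ₁ (X² + u I)⁻¹ du`. -/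
def Q (X Y : Matrix n n ℂ) : ℂ := (gammaOne X Y * resolventIntegral X Y).trace

/-- `Q̃[X, W + i Z] = Q[X, W + i Z] - 2 i Tr (W Z - Z W) log X²`, for Hermitian `W`, `Z`. -/
def Qtilde (X W Z : Matrix n n ℂ) : ℂ :=
  Q X (W + Complex.I • Z) - 2 * Complex.I * ((W * Z - Z * W) * matLog (X ^ 2)).trace

end EntropyDeriv

end

/-! ### Unitary diagonalization and the functional calculus -/

noncomputable section

namespace EntropyDeriv

variable {n : Type*} [Fintype n] [DecidableEq n]

/-! Write ρ(t) for the curve of states. Since Tr ρ (log ρ)' = Tr ρ', the first derivative of S(ρ) is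
-(Tr ρ' log ρ + Tr ρ'). Differentiating again at 0, the normalization gives Tr ρ'' = 0. What remains
is -Tr ρ'' log X² with ρ'' = 2YY† - 2X², and -Tr ρ' (log ρ)' = -Q with ρ' = Γ₁.

The derivative of log rests on the exact identity log A - log B = ∫ (A+u)⁻¹ (A-B) (B+u)⁻¹ du
(`matLog_sub_matLog`): divide by the increment of t and pass to the limit by dominated convergence
(`hasEntryDerivAt_matLog`).

In an eigenbasis of X with eigenvalues x_i, the integral multiplies the (i,j) entry by the divided
difference L of log at (x_i², x_j²), while Δ_X has eigenvalues x_i/x_j. The scalar identities φ(x/y)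
= L(x²,y²)(x+y)² and φ(-x/y) = L(x²,y²)(x-y)² then turn Q into the two modular traces plus a
commutator term (`Q_eq_traces`). -/

/-- `A = U diag(a) U†` with `U` unitary and `a` real. -/
structure IsDiagonalization (A U : Matrix n n ℂ) (a : n → ℝ) : Prop where
  conj_mul : Uᴴ * U = 1
  eq : A = U * Matrix.diagonal (fun i => (a i : ℂ)) * Uᴴ

namespace IsDiagonalization

variable {A B U V H : Matrix n n ℂ} {a b : n → ℝ}

theorem mul_conj (h : IsDiagonalization A U a) : U * Uᴴ = 1 :=
  mul_eq_one_comm.mp h.conj_mul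

theorem norm_entry_le_one (h : IsDiagonalization A U a) (i j : n) : ‖U i j‖ ≤ 1 :=
  entry_norm_bound_of_unitary (Matrix.mem_unitaryGroup_iff.mpr h.mul_conj) i j

theorem of_isHermitian (hA : A.IsHermitian) :
    IsDiagonalization A (hA.eigenvectorUnitary : Matrix n n ℂ) hA.eigenvalues where
  conj_mul := by
    simpa [Matrix.star_eq_conjTranspose] using
      Matrix.mem_unitaryGroup_iff'.mp hA.eigenvectorUnitary.2
  eq := by
    conv_lhs => rw [hA.spectral_theorem, Unitary.conjStarAlgAut_apply]
    rfl

theorem isHermitian (h : IsDiagonalization A U a) : A.IsHermitian := by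
  rw [h.eq]
  apply Matrix.isHermitian_mul_mul_conjTranspose
  ext i j
  by_cases hij : i = j
  · subst hij; simp
  · simp [Matrix.diagonal_apply_ne, hij, Ne.symm hij]

theorem mul_eq (h : IsDiagonalization A U a) :
    A * U = U * Matrix.diagonal (fun i => (a i : ℂ)) := by
  rw [h.eq, mul_assoc, h.conj_mul, mul_one]

theorem conj_mul_eq (h : IsDiagonalization A U a) :
    Uᴴ * A = Matrix.diagonal (fun i => (a i : ℂ)) * Uᴴ := by
  rw [h.eq, ← mul_assoc, ← mul_assoc, h.conj_mul, one_mul]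

theorem sq (h : IsDiagonalization A U a) : IsDiagonalization (A ^ 2) U (fun i => a i ^ 2) where
  conj_mul := h.conj_mul
  eq := by
    rw [pow_two, ← mul_one (A * A), ← h.mul_conj, ← mul_assoc, mul_assoc A A U, h.mul_eq,
      ← mul_assoc, h.mul_eq, mul_assoc U, Matrix.diagonal_mul_diagonal]
    congr 3
    ext i
    push_cast
    ring

theorem pos (h : IsDiagonalization A U a) (hA : A.PosDef) (i : n) : 0 < a i := by
  have h1 : Uᴴ * A * U = Matrix.diagonal (fun i => (a i : ℂ)) := by
    rw [h.conj_mul_eq, mul_assoc, h.conj_mul, mul_one]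
  have h2 : (Uᴴ * A * U).PosDef := by
    apply hA.conjTranspose_mul_mul_same
    intro v w hvw
    have := congrArg (fun x => Uᴴ *ᵥ x) hvw
    simpa [Matrix.mulVec_mulVec, h.conj_mul] using this
  have h3 := h2.diag_pos (i := i)
  rw [h1, Matrix.diagonal_apply_eq] at h3
  exact_mod_cast h3

end IsDiagonalization

/-- In an eigenbasis of `A`, only coordinates of `v` with eigenvalue `c` can be nonzero. No
continuity of `f` is needed in finite dimension. -/
theorem cfc_mulVec_of_eigenvector {A : Matrix n n ℂ} (hA : A.IsHermitian) (f : ℝ → ℝ)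
    {v : n → ℂ} {c : ℝ} (hv : A *ᵥ v = (c : ℂ) • v) : cfc f A *ᵥ v = (f c : ℂ) • v := by
  have hd := IsDiagonalization.of_isHermitian hA
  set U : Matrix n n ℂ := (hA.eigenvectorUnitary : Matrix n n ℂ) with hU
  have hf : cfc f A = U * Matrix.diagonal (fun i => (f (hA.eigenvalues i) : ℂ)) * Uᴴ := by
    rw [hA.cfc_eq, Matrix.IsHermitian.cfc, Unitary.conjStarAlgAut_apply]
    rfl
  have hw : ∀ i, (hA.eigenvalues i : ℂ) * (Uᴴ *ᵥ v) i = c * (Uᴴ *ᵥ v) i := by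
    intro i
    have h1 : Uᴴ *ᵥ (A *ᵥ v) = Uᴴ *ᵥ ((c : ℂ) • v) := by rw [hv]
    rw [Matrix.mulVec_mulVec, hd.conj_mul_eq, ← Matrix.mulVec_mulVec, Matrix.mulVec_smul] at h1
    simpa [Matrix.mulVec_diagonal] using congrFun h1 i
  have hfw : Matrix.diagonal (fun i => (f (hA.eigenvalues i) : ℂ)) *ᵥ (Uᴴ *ᵥ v)
      = (f c : ℂ) • (Uᴴ *ᵥ v) := by
    ext i
    rw [Matrix.mulVec_diagonal, Pi.smul_apply, smul_eq_mul]
    by_cases h0 : (Uᴴ *ᵥ v) i = 0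
    · simp [h0]
    · have h2 : hA.eigenvalues i = c := by exact_mod_cast mul_right_cancel₀ h0 (hw i)
      rw [h2]
  rw [hf, ← Matrix.mulVec_mulVec, ← Matrix.mulVec_mulVec, hfw, Matrix.mulVec_smul,
    Matrix.mulVec_mulVec, hd.mul_conj, Matrix.one_mulVec]

/-- The columns of `U` are eigenvectors of `A`. Hence any diagonalization serves, and one of `X` can
be reused for `X ^ 2` and its logarithm. -/
theorem IsDiagonalization.cfc {A U : Matrix n n ℂ} {a : n → ℝ} (h : IsDiagonalization A U a)
    (f : ℝ → ℝ) : IsDiagonalization (cfc f A) U (fun i => f (a i)) where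
  conj_mul := h.conj_mul
  eq := by
    suffices hs : _root_.cfc f A * U = U * Matrix.diagonal (fun i => (f (a i) : ℂ)) by
      rw [← hs, mul_assoc, h.mul_conj, mul_one]
    ext i j
    have h1 : A *ᵥ U.col j = (a j : ℂ) • U.col j := by
      ext k
      have := congrFun (congrFun h.mul_eq k) j
      rw [Matrix.mul_diagonal] at this
      rw [Pi.smul_apply, smul_eq_mul, mul_comm]
      exact this
    have h2 := congrFun (cfc_mulVec_of_eigenvector h.isHermitian f h1) i
    rw [Matrix.mul_diagonal, mul_comm]
    exact h2

theorem superCfc_apply_of_eigenvector {T : Matrix n n ℂ →ₗ[ℂ] Matrix n n ℂ}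
    (hT : (LinearMap.toMatrix (Matrix.stdBasis ℂ n n) (Matrix.stdBasis ℂ n n) T).IsHermitian)
    (f : ℝ → ℝ) {V : Matrix n n ℂ} {c : ℝ} (hV : T V = (c : ℂ) • V) :
    superCfc f T V = (f c : ℂ) • V := by
  set e := Matrix.stdBasis ℂ n n
  have h1 : LinearMap.toMatrix e e T *ᵥ ⇑(e.repr V) = (c : ℂ) • ⇑(e.repr V) := by
    rw [LinearMap.toMatrix_mulVec_repr, hV, map_smul]
    rfl
  rw [superCfc, Matrix.toLin_apply, cfc_mulVec_of_eigenvector hT f h1]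
  simp only [Pi.smul_apply, smul_eq_mul, mul_smul]
  rw [← Finset.smul_sum]
  congr 1
  exact e.sum_repr V

/-- In matrix units the operator is the tensor product of `X` with the transpose of `X⁻¹`, both
Hermitian. This makes the functional calculus in `superCfc` meaningful. -/
theorem modularOp_toMatrix_isHermitian {X : Matrix n n ℂ} (hX : X.IsHermitian) :
    (LinearMap.toMatrix (Matrix.stdBasis ℂ n n) (Matrix.stdBasis ℂ n n)
      (modularOp X)).IsHermitian := by
  have key : ∀ p q : n × n, LinearMap.toMatrix (Matrix.stdBasis ℂ n n) (Matrix.stdBasis ℂ n n)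
      (modularOp X) p q = X p.1 q.1 * X⁻¹ q.2 p.2 := by
    rintro ⟨i, j⟩ ⟨k, l⟩
    rw [LinearMap.toMatrix_apply, Matrix.stdBasis_eq_single]
    have : ∀ M : Matrix n n ℂ, (Matrix.stdBasis ℂ n n).repr M (i, j) = M i j := by
      intro M
      simp [Matrix.stdBasis]
    rw [this]
    simp [modularOp, Matrix.mul_apply, Matrix.single_apply, ite_and, Finset.sum_ite_eq]
  ext p q
  rw [Matrix.conjTranspose_apply, key, key, star_mul', hX.apply, hX.inv.apply]

/-- The matrices U E_ij U† are eigenvectors of s Δ_X with eigenvalue s x_i/x_j; expand `A` in them.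
The values s = 1 and s = -1 serve φ(Δ_X) and φ(-Δ_X). -/
theorem trace_mul_superCfc {X U : Matrix n n ℂ} {x : n → ℝ} (h : IsDiagonalization X U x)
    (hx : ∀ i, 0 < x i) (f : ℝ → ℝ) (s : ℝ) (A : Matrix n n ℂ) :
    (A * superCfc f ((s : ℂ) • modularOp X) A).trace =
      ∑ i, ∑ j, (f (s * (x i / x j)) : ℂ) * ((Uᴴ * A * U) i j * (Uᴴ * A * U) j i) := by
  have hinv : X⁻¹ = U * Matrix.diagonal (fun i => ((x i)⁻¹ : ℂ)) * Uᴴ := by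
    apply Matrix.inv_eq_right_inv
    rw [h.eq]
    calc _ = U * (Matrix.diagonal (fun i => (x i : ℂ)) * (Uᴴ * U) *
          Matrix.diagonal (fun i => ((x i)⁻¹ : ℂ))) * Uᴴ := by noncomm_ring
      _ = 1 := by
        rw [h.conj_mul, mul_one, Matrix.diagonal_mul_diagonal]
        have : ∀ i, (x i : ℂ) * (x i : ℂ)⁻¹ = 1 := fun i =>
          mul_inv_cancel₀ (by exact_mod_cast (hx i).ne')
        simp [this, h.mul_conj]
  have hH : (LinearMap.toMatrix (Matrix.stdBasis ℂ n n) (Matrix.stdBasis ℂ n n)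
      ((s : ℂ) • modularOp X)).IsHermitian := by
    rw [map_smul]
    exact (modularOp_toMatrix_isHermitian h.isHermitian).smul (by simp [IsSelfAdjoint])
  set B := Uᴴ * A * U with hB
  have hA : A = ∑ i, ∑ j, B i j • (U * Matrix.single i j 1 * Uᴴ) := by
    have : A = U * B * Uᴴ := by
      rw [hB]
      calc A = (U * Uᴴ) * A * (U * Uᴴ) := by rw [h.mul_conj, one_mul, mul_one]
        _ = _ := by noncomm_ring
    conv_lhs => rw [this, Matrix.matrix_eq_sum_single B]
    simp only [Finset.mul_sum, Finset.sum_mul]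
    refine Finset.sum_congr rfl fun i _ => Finset.sum_congr rfl fun j _ => ?_
    rw [← Matrix.smul_mul, ← Matrix.mul_smul, Matrix.smul_single, smul_eq_mul, mul_one]
  have heig : ∀ i j, ((s : ℂ) • modularOp X) (U * Matrix.single i j 1 * Uᴴ) =
      ((s * (x i / x j) : ℝ) : ℂ) • (U * Matrix.single i j 1 * Uᴴ) := by
    intro i j
    have : X * ((U * Matrix.single i j 1 * Uᴴ) * X⁻¹) =
        U * (Matrix.diagonal (fun i => (x i : ℂ)) * Matrix.single i j 1 *
          Matrix.diagonal (fun i => ((x i)⁻¹ : ℂ))) * Uᴴ := by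
      rw [hinv, h.eq]
      calc _ = U * (Matrix.diagonal (fun i => (x i : ℂ)) * (Uᴴ * U) * Matrix.single i j 1 *
          (Uᴴ * U) * Matrix.diagonal (fun i => ((x i)⁻¹ : ℂ))) * Uᴴ := by noncomm_ring
        _ = _ := by rw [h.conj_mul]; simp only [mul_one]
    have h2 : Matrix.diagonal (fun i => (x i : ℂ)) * Matrix.single i j 1 *
          Matrix.diagonal (fun i => ((x i)⁻¹ : ℂ)) = (x i / x j : ℂ) • Matrix.single i j 1 := by
      ext k l
      rw [Matrix.mul_diagonal, Matrix.diagonal_mul, Matrix.smul_apply, Matrix.single_apply]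
      split_ifs with hkl
      · rw [hkl.1, hkl.2, smul_eq_mul, div_eq_mul_inv]; ring
      · simp
    rw [LinearMap.smul_apply]
    change (s : ℂ) • (X * ((U * Matrix.single i j 1 * Uᴴ) * X⁻¹)) = _
    rw [this, h2, Matrix.mul_smul, Matrix.smul_mul, smul_smul]
    push_cast
    rfl
  conv_lhs => rw [hA, map_sum]
  rw [← hA, Finset.mul_sum, Matrix.trace_sum]
  refine Finset.sum_congr rfl fun i _ => ?_
  rw [map_sum, Finset.mul_sum, Matrix.trace_sum]
  refine Finset.sum_congr rfl fun j _ => ?_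
  rw [map_smul, superCfc_apply_of_eigenvector hH f (heig i j), Matrix.mul_smul, Matrix.mul_smul,
    Matrix.trace_smul, Matrix.trace_smul, ← mul_assoc, Matrix.trace_mul_comm, ← mul_assoc,
    ← mul_assoc, ← hB, Matrix.trace_mul_single]
  simp only [smul_eq_mul]
  simp
  ring

end EntropyDeriv
end

/-! ### Resolvent integrals and divided differences of the logarithm -/

noncomputable section

namespace EntropyDeriv

open MeasureTheory Set Filter Topology

variable {n : Type*} [Fintype n] [DecidableEq n]

/-- The first divided difference of the logarithm. -/
def logDivDiff (a b : ℝ) : ℝ :=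
  if a = b then a⁻¹ else (Real.log a - Real.log b) / (a - b)

theorem sub_mul_logDivDiff (a b : ℝ) :
    (a - b) * logDivDiff a b = Real.log a - Real.log b := by
  unfold logDivDiff
  split_ifs with h
  · simp [h]
  · rw [mul_div_cancel₀ _ (sub_ne_zero.mpr h)]

/-- There is an explicit antiderivative vanishing at infinity; as the integrand is nonnegative, this
yields integrability as well as the value. -/
theorem integrableOn_inv_mul_inv_and_integral {a b : ℝ} (ha : 0 < a) (hb : 0 < b) :
    IntegrableOn (fun u : ℝ => (a + u)⁻¹ * (b + u)⁻¹) (Ioi 0) ∧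
      ∫ u in Ioi (0 : ℝ), (a + u)⁻¹ * (b + u)⁻¹ = logDivDiff a b := by
  have hnonneg : ∀ u ∈ Ioi (0 : ℝ), 0 ≤ (a + u)⁻¹ * (b + u)⁻¹ := by
    intro u hu
    have : 0 < u := hu
    positivity
  suffices hs : ∃ g : ℝ → ℝ, (∀ u ∈ Ici (0 : ℝ), HasDerivAt g ((a + u)⁻¹ * (b + u)⁻¹) u) ∧
      Tendsto g atTop (𝓝 0) ∧ -g 0 = logDivDiff a b by
    obtain ⟨g, h1, h2, h3⟩ := hs
    refine ⟨integrableOn_Ioi_deriv_of_nonneg' h1 hnonneg h2, ?_⟩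
    rw [integral_Ioi_of_hasDerivAt_of_nonneg' h1 hnonneg h2, zero_sub, h3]
  have hlin : ∀ c : ℝ, Tendsto (fun u : ℝ => c + u) atTop atTop := fun c =>
    tendsto_atTop_add_const_left _ _ tendsto_id
  by_cases hab : a = b
  · subst hab
    refine ⟨fun u => -(a + u)⁻¹, ?_, ?_, by simp [logDivDiff]⟩
    · intro u hu
      have hu0 : a + u ≠ 0 := by
        have : 0 ≤ u := hu
        positivity
      have := (((hasDerivAt_id u).const_add a).inv hu0).neg
      refine this.congr_deriv ?_
      simp only [id]
      field_simp
    · simpa using (tendsto_inv_atTop_zero.comp (hlin a)).neg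
  · have hne : a - b ≠ 0 := sub_ne_zero.mpr hab
    refine ⟨fun u => (Real.log (b + u) - Real.log (a + u)) / (a - b), ?_, ?_, ?_⟩
    · intro u hu
      have hu0 : 0 ≤ u := hu
      have ha0 : a + u ≠ 0 := by positivity
      have hb0 : b + u ≠ 0 := by positivity
      have h1 := ((hasDerivAt_id u).const_add a).log ha0
      have h2 := ((hasDerivAt_id u).const_add b).log hb0
      refine ((h2.sub h1).div_const (a - b)).congr_deriv ?_
      simp only [id]
      field_simp
      ring
    -- Here (b + u)/(a + u) = 1 + (b - a)/(a + u) tends to 1, so its logarithm tends to 0.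
    · have h1 : Tendsto (fun u : ℝ => (b - a) * (a + u)⁻¹ + 1) atTop (𝓝 1) := by
        simpa using ((tendsto_inv_atTop_zero.comp (hlin a)).const_mul (b - a)).add_const 1
      have h2 := ((Real.continuousAt_log one_ne_zero).tendsto.comp h1).div_const (a - b)
      rw [Real.log_one, zero_div] at h2
      refine h2.congr' ?_
      filter_upwards [eventually_gt_atTop 0] with u hu
      have ha0 : a + u ≠ 0 := by positivity
      have hb0 : b + u ≠ 0 := by positivity
      rw [Function.comp_apply, ← Real.log_div hb0 ha0]
      congr 2
      field_simp
      ring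
    · simp only [add_zero, logDivDiff, if_neg hab]
      ring

/-- The resolvent `(A + u I)⁻¹`. -/
def resolventAt (A : Matrix n n ℂ) (u : ℝ) : Matrix n n ℂ :=
  (A + (u : ℂ) • (1 : Matrix n n ℂ))⁻¹

/-- `∫₀^∞ (A + u I)⁻¹ H (B + u I)⁻¹ du`, entry by entry. -/
def resolventSandwich (A H B : Matrix n n ℂ) : Matrix n n ℂ :=
  Matrix.of fun i j => ∫ u in Ioi (0 : ℝ), (resolventAt A u * H * resolventAt B u) i j

namespace IsDiagonalization

variable {A B U V : Matrix n n ℂ} {a b : n → ℝ}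

theorem resolventAt (h : IsDiagonalization A U a) (ha : ∀ i, 0 < a i) {u : ℝ} (hu : 0 ≤ u) :
    resolventAt A u = U * Matrix.diagonal (fun i => (((a i + u)⁻¹ : ℝ) : ℂ)) * Uᴴ := by
  apply Matrix.inv_eq_right_inv
  have h1 : A + (u : ℂ) • (1 : Matrix n n ℂ) =
      U * Matrix.diagonal (fun i => ((a i + u : ℝ) : ℂ)) * Uᴴ := by
    have : Matrix.diagonal (fun i => ((a i + u : ℝ) : ℂ)) =
        Matrix.diagonal (fun i => (a i : ℂ)) + (u : ℂ) • (1 : Matrix n n ℂ) := by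
      rw [Matrix.smul_one_eq_diagonal, Matrix.diagonal_add]
      simp
    rw [this, mul_add, add_mul, ← h.eq, Matrix.mul_smul, Matrix.smul_mul, mul_one, h.mul_conj]
  rw [h1]
  calc _ = U * (Matrix.diagonal (fun i => ((a i + u : ℝ) : ℂ)) * (Uᴴ * U) *
        Matrix.diagonal (fun i => (((a i + u)⁻¹ : ℝ) : ℂ))) * Uᴴ := by noncomm_ring
    _ = 1 := by
      rw [h.conj_mul, mul_one, Matrix.diagonal_mul_diagonal]
      have : ∀ i, ((a i + u : ℝ) : ℂ) * (((a i + u)⁻¹ : ℝ) : ℂ) = 1 := fun i => by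
        rw [← Complex.ofReal_mul, mul_inv_cancel₀ (by have := ha i; positivity),
          Complex.ofReal_one]
      simp only [this]
      simp [h.mul_conj]

theorem resolvent_mul_mul_resolvent_apply (hA : IsDiagonalization A U a) (ha : ∀ i, 0 < a i)
    (hB : IsDiagonalization B V b) (hb : ∀ i, 0 < b i) (H : Matrix n n ℂ) {u : ℝ} (hu : 0 ≤ u)
    (i j : n) :
    (EntropyDeriv.resolventAt A u * H * EntropyDeriv.resolventAt B u) i j =
      ∑ l, ∑ k, (U i k * (Uᴴ * H * V) k l * Vᴴ l j) *
        (((a k + u)⁻¹ * (b l + u)⁻¹ : ℝ) : ℂ) := by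
  rw [hA.resolventAt ha hu, hB.resolventAt hb hu]
  have : U * Matrix.diagonal (fun i => (((a i + u)⁻¹ : ℝ) : ℂ)) * Uᴴ * H *
      (V * Matrix.diagonal (fun i => (((b i + u)⁻¹ : ℝ) : ℂ)) * Vᴴ) =
      U * (Matrix.diagonal (fun i => (((a i + u)⁻¹ : ℝ) : ℂ)) * (Uᴴ * H * V) *
        Matrix.diagonal (fun i => (((b i + u)⁻¹ : ℝ) : ℂ))) * Vᴴ := by noncomm_ring
  rw [this, Matrix.mul_apply]
  refine Finset.sum_congr rfl fun l _ => ?_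
  rw [Matrix.mul_apply, Finset.sum_mul]
  refine Finset.sum_congr rfl fun k _ => ?_
  rw [Matrix.mul_diagonal, Matrix.diagonal_mul]
  push_cast
  ring

theorem integrableOn_resolvent_mul_mul_resolvent (hA : IsDiagonalization A U a)
    (ha : ∀ i, 0 < a i) (hB : IsDiagonalization B V b) (hb : ∀ i, 0 < b i) (H : Matrix n n ℂ)
    (i j : n) :
    IntegrableOn (fun u : ℝ =>
      (EntropyDeriv.resolventAt A u * H * EntropyDeriv.resolventAt B u) i j) (Ioi 0) := by
  refine IntegrableOn.congr_fun ?_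
    (fun u hu => (hA.resolvent_mul_mul_resolvent_apply ha hB hb H (le_of_lt hu) i j).symm)
    measurableSet_Ioi
  refine integrable_finsetSum _ fun l _ => integrable_finsetSum _ fun k _ => ?_
  exact ((integrableOn_inv_mul_inv_and_integral (ha k) (hb l)).1.ofReal).const_mul _

theorem resolventSandwich (hA : IsDiagonalization A U a) (ha : ∀ i, 0 < a i)
    (hB : IsDiagonalization B V b) (hb : ∀ i, 0 < b i) (H : Matrix n n ℂ) :
    resolventSandwich A H B =
      U * Matrix.of (fun k l => (logDivDiff (a k) (b l) : ℂ) * (Uᴴ * H * V) k l) * Vᴴ := by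
  ext i j
  rw [EntropyDeriv.resolventSandwich, Matrix.of_apply, setIntegral_congr_fun measurableSet_Ioi
    (fun u hu => hA.resolvent_mul_mul_resolvent_apply ha hB hb H (le_of_lt hu) i j)]
  have hint : ∀ k l, IntegrableOn (fun u : ℝ => (U i k * (Uᴴ * H * V) k l * Vᴴ l j) *
        (((a k + u)⁻¹ * (b l + u)⁻¹ : ℝ) : ℂ)) (Ioi 0) := fun k l =>
    ((integrableOn_inv_mul_inv_and_integral (ha k) (hb l)).1.ofReal).const_mul _
  rw [integral_finsetSum _ fun l _ => integrable_finsetSum _ fun k _ => hint k l,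
    Matrix.mul_apply]
  refine Finset.sum_congr rfl fun l _ => ?_
  rw [integral_finsetSum _ fun k _ => hint k l, Matrix.mul_apply, Finset.sum_mul]
  refine Finset.sum_congr rfl fun k _ => ?_
  rw [integral_const_mul, integral_complex_ofReal,
    (integrableOn_inv_mul_inv_and_integral (ha k) (hb l)).2, Matrix.of_apply]
  ring

/-- Between the two eigenbases, A - B has entries (a_k - b_l)(U†V)_kl and log A - log B has entries
(log a_k - log b_l)(U†V)_kl. Their ratio is the divided difference, so the identity is exact even
when `A` and `B` do not commute. -/
theorem matLog_sub_matLog (hA : IsDiagonalization A U a) (ha : ∀ i, 0 < a i)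
    (hB : IsDiagonalization B V b) (hb : ∀ i, 0 < b i) :
    matLog A - matLog B = EntropyDeriv.resolventSandwich A (A - B) B := by
  have key : ∀ {a' b' : n → ℝ} {A' B' : Matrix n n ℂ}, IsDiagonalization A' U a' →
      IsDiagonalization B' V b' → ∀ k l, (Uᴴ * (A' - B') * V) k l =
        ((a' k : ℂ) - b' l) * (Uᴴ * V) k l := by
    intro a' b' A' B' hA' hB' k l
    rw [mul_sub, sub_mul, hA'.conj_mul_eq, mul_assoc Uᴴ B', hB'.mul_eq, mul_assoc, ← mul_assoc Uᴴ V,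
      Matrix.sub_apply, Matrix.diagonal_mul, Matrix.mul_diagonal]
    ring
  rw [hA.resolventSandwich ha hB hb]
  have hlog : Matrix.of (fun k l => (logDivDiff (a k) (b l) : ℂ) * (Uᴴ * (A - B) * V) k l) =
      Uᴴ * (matLog A - matLog B) * V := by
    ext k l
    rw [Matrix.of_apply, key hA hB, matLog, matLog, key (hA.cfc Real.log) (hB.cfc Real.log),
      ← Complex.ofReal_sub (Real.log _), ← sub_mul_logDivDiff]
    push_cast
    ring
  rw [hlog]
  calc _ = (U * Uᴴ) * (matLog A - matLog B) * (V * Vᴴ) := by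
        rw [hA.mul_conj, hB.mul_conj, one_mul, mul_one]
    _ = _ := by noncomm_ring

theorem trace_mul_resolventSandwich (hA : IsDiagonalization A U a) (ha : ∀ i, 0 < a i)
    (G H : Matrix n n ℂ) :
    (G * EntropyDeriv.resolventSandwich A H A).trace =
      ∑ i, ∑ j, (logDivDiff (a i) (a j) : ℂ) * ((Uᴴ * H * U) i j * (Uᴴ * G * U) j i) := by
  rw [hA.resolventSandwich ha hA ha, ← mul_assoc, ← mul_assoc, Matrix.trace_mul_comm, ← mul_assoc,
    ← mul_assoc, Matrix.trace_mul_comm, Matrix.trace]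
  refine Finset.sum_congr rfl fun i _ => ?_
  rw [Matrix.diag_apply, Matrix.mul_apply]
  refine Finset.sum_congr rfl fun j _ => ?_
  rw [Matrix.of_apply]
  ring

/-- Pairing with `A` leaves only diagonal entries, where the divided difference 1/a_i cancels a_i.
This is Tr ρ (log ρ)' = Tr ρ'. -/
theorem trace_mul_resolventSandwich_self (hA : IsDiagonalization A U a) (ha : ∀ i, 0 < a i)
    (H : Matrix n n ℂ) : (A * EntropyDeriv.resolventSandwich A H A).trace = H.trace := by
  rw [hA.trace_mul_resolventSandwich ha]
  have h1 : Uᴴ * A * U = Matrix.diagonal (fun i => (a i : ℂ)) := by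
    rw [hA.conj_mul_eq, mul_assoc, hA.conj_mul, mul_one]
  have h2 : H.trace = (Uᴴ * H * U).trace := by
    rw [Matrix.trace_mul_comm, ← mul_assoc, hA.mul_conj, one_mul]
  rw [h1, h2, Matrix.trace]
  refine Finset.sum_congr rfl fun i _ => ?_
  rw [Finset.sum_eq_single i]
  · have : (a i : ℂ) ≠ 0 := by exact_mod_cast (ha i).ne'
    simp only [logDivDiff, if_true, Matrix.diagonal_apply_eq, Matrix.diag_apply]
    push_cast
    field_simp
  · intro j _ hj
    rw [Matrix.diagonal_apply_ne _ hj, mul_zero, mul_zero]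
  · simp

theorem norm_resolventAt_apply_le (hA : IsDiagonalization A U a) {m : ℝ} (hm : 0 < m)
    (ha : ∀ i, m ≤ a i) {u : ℝ} (hu : 0 ≤ u) (i j : n) :
    ‖EntropyDeriv.resolventAt A u i j‖ ≤ Fintype.card n * (m + u)⁻¹ := by
  rw [hA.resolventAt (fun i => hm.trans_le (ha i)) hu, Matrix.mul_apply]
  refine (norm_sum_le _ _).trans ?_
  rw [← nsmul_eq_mul]
  refine Finset.sum_le_card_nsmul _ _ _ fun k _ => ?_
  rw [Matrix.mul_diagonal, norm_mul, norm_mul, Matrix.conjTranspose_apply, norm_star,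
    Complex.norm_real, Real.norm_of_nonneg (inv_nonneg.mpr (by linarith [ha k]))]
  have h1 := hA.norm_entry_le_one i k
  have h2 := hA.norm_entry_le_one j k
  have h3 : (a k + u)⁻¹ ≤ (m + u)⁻¹ := inv_anti₀ (by positivity) (by linarith [ha k])
  have h4 : 0 ≤ (a k + u)⁻¹ := inv_nonneg.mpr (by linarith [ha k])
  calc ‖U i k‖ * (a k + u)⁻¹ * ‖U j k‖ ≤ 1 * (a k + u)⁻¹ * 1 := by gcongr
    _ ≤ _ := by simpa using h3

/-- Bounds the spectrum away from 0 by a quantity continuous in `A`, avoiding any continuity of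
eigenvalues along a curve. -/
theorem inv_le_sum_norm_inv (hA : IsDiagonalization A U a) (ha : ∀ i, 0 < a i) (k : n) :
    (a k)⁻¹ ≤ ∑ i, ∑ j, ‖A⁻¹ i j‖ := by
  have h0 : A⁻¹ = U * Matrix.diagonal (fun i => (((a i)⁻¹ : ℝ) : ℂ)) * Uᴴ := by
    simpa [EntropyDeriv.resolventAt] using hA.resolventAt ha le_rfl
  have h1 : Uᴴ * A⁻¹ * U = Matrix.diagonal (fun i => (((a i)⁻¹ : ℝ) : ℂ)) := by
    rw [h0]
    calc _ = (Uᴴ * U) * Matrix.diagonal (fun i => (((a i)⁻¹ : ℝ) : ℂ)) * (Uᴴ * U) := by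
          noncomm_ring
      _ = _ := by rw [hA.conj_mul, one_mul, mul_one]
  have h2 : ‖(Uᴴ * A⁻¹ * U) k k‖ = (a k)⁻¹ := by
    rw [h1, Matrix.diagonal_apply_eq, Complex.norm_real,
      Real.norm_of_nonneg (inv_nonneg.mpr (ha k).le)]
  rw [← h2, Matrix.mul_apply, Finset.sum_comm]
  refine (norm_sum_le _ _).trans (Finset.sum_le_sum fun j _ => ?_)
  rw [Matrix.mul_apply, Finset.sum_mul]
  refine (norm_sum_le _ _).trans (Finset.sum_le_sum fun i _ => ?_)
  rw [norm_mul, norm_mul, Matrix.conjTranspose_apply, norm_star]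
  have h3 := hA.norm_entry_le_one i k
  have h4 := hA.norm_entry_le_one j k
  calc ‖U i k‖ * ‖A⁻¹ i j‖ * ‖U j k‖ ≤ 1 * ‖A⁻¹ i j‖ * 1 := by gcongr
    _ = _ := by ring

end IsDiagonalization

end EntropyDeriv
end

/-! ### Derivatives of the matrix logarithm and of the entropy -/

noncomputable section

namespace EntropyDeriv

open MeasureTheory Set Filter Topology

variable {n : Type*}

/-- Entrywise derivative of a matrix-valued function. -/
def HasEntryDerivAt (F : ℝ → Matrix n n ℂ) (F' : Matrix n n ℂ) (t : ℝ) : Prop :=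
  ∀ i j, HasDerivAt (fun s => F s i j) (F' i j) t

namespace HasEntryDerivAt

variable {F G : ℝ → Matrix n n ℂ} {F' G' : Matrix n n ℂ} {t : ℝ}

theorem continuousAt (hF : HasEntryDerivAt F F' t) : ContinuousAt F t :=
  tendsto_pi_nhds.mpr fun i => tendsto_pi_nhds.mpr fun j => (hF i j).continuousAt

theorem mul [Fintype n] (hF : HasEntryDerivAt F F' t) (hG : HasEntryDerivAt G G' t) :
    HasEntryDerivAt (fun s => F s * G s) (F' * G t + F t * G') t := by
  intro i j
  simp only [Matrix.mul_apply, Matrix.add_apply, ← Finset.sum_add_distrib]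
  exact HasDerivAt.fun_sum fun k _ => (hF i k).mul (hG k j)

theorem add (hF : HasEntryDerivAt F F' t) (hG : HasEntryDerivAt G G' t) :
    HasEntryDerivAt (fun s => F s + G s) (F' + G') t :=
  fun i j => (hF i j).add (hG i j)

theorem conjTranspose (hF : HasEntryDerivAt F F' t) :
    HasEntryDerivAt (fun s => (F s)ᴴ) F'ᴴ t :=
  fun i j => (hF j i).star

theorem smul_const {f : ℝ → ℝ} {f' : ℝ} (hf : HasDerivAt f f' t) (A : Matrix n n ℂ) :
    HasEntryDerivAt (fun s => (f s : ℂ) • A) ((f' : ℂ) • A) t :=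
  fun i j => hf.ofReal_comp.mul_const (A i j)

theorem trace [Fintype n] (hF : HasEntryDerivAt F F' t) :
    HasDerivAt (fun s => (F s).trace) F'.trace t :=
  HasDerivAt.fun_sum fun i _ => hF i i

end HasEntryDerivAt

variable [Fintype n] [DecidableEq n]

theorem continuousAt_inv_of_isUnit {A : Matrix n n ℂ} (hA : IsUnit A) :
    ContinuousAt (fun B : Matrix n n ℂ => B⁻¹) A := by
  have hdet : A.det ≠ 0 := ((Matrix.isUnit_iff_isUnit_det A).mp hA).ne_zero
  simp only [Matrix.inv_def, Ring.inverse_eq_inv']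
  exact ((continuous_id.matrix_det).continuousAt.inv₀ hdet).smul
    (continuous_id.matrix_adjugate).continuousAt

theorem isUnit_add_smul_one {A : Matrix n n ℂ} (hA : A.PosDef) {u : ℝ} (hu : 0 ≤ u) :
    IsUnit (A + (u : ℂ) • (1 : Matrix n n ℂ)) := by
  apply Matrix.PosDef.isUnit
  apply hA.add_posSemidef
  exact Matrix.PosSemidef.one.smul (by exact_mod_cast hu)

/-- By `matLog_sub_matLog` the difference quotient is itself a resolvent integral, with the slope of
`ρ` in the middle. Near `t` the resolvents are O((S⁻¹ + u)⁻¹) uniformly, so dominated convergence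
applies. -/
theorem hasEntryDerivAt_matLog {ρ : ℝ → Matrix n n ℂ} {ρ' : Matrix n n ℂ} {t : ℝ}
    (hρ : HasEntryDerivAt ρ ρ' t) (hpos : ∀ᶠ s in 𝓝 t, (ρ s).PosDef) :
    HasEntryDerivAt (fun s => matLog (ρ s)) (resolventSandwich (ρ t) ρ' (ρ t)) t := by
  intro i j
  have hcard : (0 : ℝ) < Fintype.card n := by
    have : Nonempty n := ⟨i⟩
    exact_mod_cast Fintype.card_pos
  have hA : (ρ t).PosDef := hpos.self_of_nhds
  have hinv : ContinuousAt (fun s => (ρ s)⁻¹) t :=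
    ContinuousAt.comp (f := ρ) (continuousAt_inv_of_isUnit hA.isUnit) hρ.continuousAt
  have hsum : ∀ᶠ s in 𝓝 t, ∑ i, ∑ j, ‖(ρ s)⁻¹ i j‖ < (∑ i, ∑ j, ‖(ρ t)⁻¹ i j‖) + 1 := by
    have : ContinuousAt (fun s => ∑ i, ∑ j, ‖(ρ s)⁻¹ i j‖) t :=
      tendsto_finsetSum _ fun i _ => tendsto_finsetSum _ fun j _ =>
        (tendsto_pi_nhds.mp (tendsto_pi_nhds.mp hinv i) j).norm
    exact this.eventually_lt_const (by linarith)
  set S := (∑ i, ∑ j, ‖(ρ t)⁻¹ i j‖) + 1 with hS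
  have hS0 : 0 < S := by positivity
  have hbound : ∀ᶠ s in 𝓝 t, ∀ u, 0 ≤ u → ∀ i j,
      ‖resolventAt (ρ s) u i j‖ ≤ Fintype.card n * (S⁻¹ + u)⁻¹ := by
    filter_upwards [hpos, hsum] with s hs1 hs2 u hu i j
    have hd := IsDiagonalization.of_isHermitian hs1.isHermitian
    refine hd.norm_resolventAt_apply_le (inv_pos.mpr hS0) (fun k => ?_) hu i j
    exact inv_le_of_inv_le₀ (hd.pos hs1 k) ((hd.inv_le_sum_norm_inv (hd.pos hs1) k).trans hs2.le)
  have hslope : ∀ k l, Tendsto (fun s => slope (fun s => ρ s k l) t s) (𝓝[≠] t) (𝓝 (ρ' k l)) :=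
    fun k l => hasDerivAt_iff_tendsto_slope.mp (hρ k l)
  have hslope_bound : ∀ᶠ s in 𝓝[≠] t, ∀ k l,
      ‖slope (fun s => ρ s k l) t s‖ ≤ ∑ i, ∑ j, (‖ρ' i j‖ + 1) := by
    rw [eventually_all]
    intro k
    rw [eventually_all]
    intro l
    filter_upwards [(hslope k l).norm.eventually_lt_const (lt_add_one _)] with s hs
    refine hs.le.trans ?_
    refine le_trans ?_ (Finset.single_le_sum (f := fun i => ∑ j, (‖ρ' i j‖ + 1))
      (fun i _ => by positivity) (Finset.mem_univ k))
    exact Finset.single_le_sum (f := fun j => ‖ρ' k j‖ + 1)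
      (fun i _ => by positivity) (Finset.mem_univ l)
  set C := ∑ i, ∑ j, (‖ρ' i j‖ + 1) with hC
  have hC0 : 0 ≤ C := by positivity
  set D : ℝ → Matrix n n ℂ := fun s => Matrix.of fun k l => slope (fun s => ρ s k l) t s with hD
  have hDeq : ∀ s, D s = ((s - t : ℝ) : ℂ)⁻¹ • (ρ s - ρ t) := by
    intro s
    ext k l
    simp [hD, slope_def_module]
  have hslope_log : ∀ᶠ s in 𝓝[≠] t, slope (fun s => matLog (ρ s) i j) t s =
      ∫ u in Ioi (0 : ℝ), (resolventAt (ρ s) u * D s * resolventAt (ρ t) u) i j := by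
    filter_upwards [nhdsWithin_le_nhds hpos] with s hs
    have hd := IsDiagonalization.of_isHermitian hs.isHermitian
    have hd0 := IsDiagonalization.of_isHermitian hA.isHermitian
    have h1 := congrFun (congrFun (hd.matLog_sub_matLog (hd.pos hs) hd0 (hd0.pos hA)) i) j
    rw [resolventSandwich, Matrix.of_apply, Matrix.sub_apply] at h1
    rw [slope_def_module, h1, hDeq]
    simp only [Matrix.mul_smul, Matrix.smul_mul, Matrix.smul_apply, smul_eq_mul]
    rw [integral_const_mul, Complex.real_smul, Complex.ofReal_inv]
  rw [hasDerivAt_iff_tendsto_slope]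
  refine Tendsto.congr' (hslope_log.mono fun s hs => hs.symm) ?_
  rw [resolventSandwich, Matrix.of_apply]
  have hR : ∀ u : ℝ, 0 ≤ u → ContinuousAt (fun s => resolventAt (ρ s) u) t := fun u hu =>
    ContinuousAt.comp (f := fun s => ρ s + (u : ℂ) • (1 : Matrix n n ℂ))
      (continuousAt_inv_of_isUnit (isUnit_add_smul_one hA hu))
      (hρ.continuousAt.add continuousAt_const)
  refine tendsto_integral_filter_of_dominated_convergence
    -- Each resolvent entry contributes card n · (S⁻¹ + u)⁻¹, the slope contributes `C`, and the two
    -- matrix products contribute sums of card n terms.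
    (fun u => (Fintype.card n * (Fintype.card n * (Fintype.card n * C * Fintype.card n))) *
      ((S⁻¹ + u)⁻¹ * (S⁻¹ + u)⁻¹)) ?_ ?_ ?_ ?_
  · filter_upwards [nhdsWithin_le_nhds hpos] with s hs
    have hd := IsDiagonalization.of_isHermitian hs.isHermitian
    have hd0 := IsDiagonalization.of_isHermitian hA.isHermitian
    exact (hd.integrableOn_resolvent_mul_mul_resolvent (hd.pos hs) hd0 (hd0.pos hA)
      (D s) i j).aestronglyMeasurable
  · filter_upwards [nhdsWithin_le_nhds hbound, hslope_bound] with s hs1 hs2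
    refine (ae_restrict_iff' measurableSet_Ioi).mpr (Eventually.of_forall fun u hu => ?_)
    have hu0 : 0 ≤ u := le_of_lt hu
    have hw : 0 ≤ (S⁻¹ + u)⁻¹ := by positivity
    rw [Matrix.mul_apply]
    refine (norm_sum_le _ _).trans ?_
    rw [mul_assoc, ← nsmul_eq_mul]
    refine Finset.sum_le_card_nsmul _ _ _ fun l _ => ?_
    rw [norm_mul, Matrix.mul_apply]
    have h1 : ‖∑ k, resolventAt (ρ s) u i k * D s k l‖ ≤
        Fintype.card n * ((Fintype.card n * (S⁻¹ + u)⁻¹) * C) := by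
      refine (norm_sum_le _ _).trans ?_
      rw [← nsmul_eq_mul]
      refine Finset.sum_le_card_nsmul _ _ _ fun k _ => ?_
      rw [norm_mul]
      exact mul_le_mul (hs1 u hu0 i k) (hs2 k l) (norm_nonneg _) (by positivity)
    refine (mul_le_mul h1 (hbound.self_of_nhds u hu0 l j) (norm_nonneg _)
      (by positivity)).trans (le_of_eq (by ring))
  · exact ((integrableOn_inv_mul_inv_and_integral (inv_pos.mpr hS0) (inv_pos.mpr hS0)).1).const_mul
      _
  · refine (ae_restrict_iff' measurableSet_Ioi).mpr (Eventually.of_forall fun u hu => ?_)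
    simp only [Matrix.mul_apply]
    refine tendsto_finsetSum _ fun l _ => Tendsto.mul (tendsto_finsetSum _ fun k _ => ?_)
      tendsto_const_nhds
    exact ((tendsto_pi_nhds.mp (tendsto_pi_nhds.mp (hR u (le_of_lt hu)) i) k).mono_left
      nhdsWithin_le_nhds).mul (hslope k l)

/-- Derivatives can be computed with complex traces: realness of the result follows from uniqueness
of the derivative. -/
theorem hasDerivAt_re_and_ofReal_re {f : ℝ → ℝ} {z : ℂ} {t : ℝ}
    (h : HasDerivAt (fun s => (f s : ℂ)) z t) :
    HasDerivAt f z.re t ∧ ((z.re : ℝ) : ℂ) = z := by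
  have h1 : HasDerivAt f z.re t := by
    exact Complex.reCLM.hasFDerivAt.comp_hasDerivAt t h
  exact ⟨h1, h1.ofReal_comp.unique h⟩

/-- The first derivative of the entropy along a curve of positive definite matrices. -/
theorem hasDerivAt_ofReal_entropy {ρ : ℝ → Matrix n n ℂ} {ρ' : Matrix n n ℂ} {t : ℝ}
    (hρ : HasEntryDerivAt ρ ρ' t) (hpos : ∀ᶠ s in 𝓝 t, (ρ s).PosDef) :
    HasDerivAt (fun s => (entropy (ρ s) : ℂ))
      (-((ρ' * matLog (ρ t)).trace + ρ'.trace)) t := by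
  have hd := IsDiagonalization.of_isHermitian hpos.self_of_nhds.isHermitian
  have h1 := (hρ.mul (hasEntryDerivAt_matLog hρ hpos)).trace.neg
  rw [Matrix.trace_add, hd.trace_mul_resolventSandwich_self (hd.pos hpos.self_of_nhds)] at h1
  refine h1.congr_of_eventuallyEq ?_
  filter_upwards [hpos] with s hs
  exact ofReal_entropy hs.isHermitian

end EntropyDeriv
end

/-! ### The entropy along the curve -/

noncomputable section

namespace EntropyDeriv

open MeasureTheory Set Filter Topology

variable {n : Type*}

/-- The derivative of the curve `t ↦ √(1 - t²) X + t Y`, for `|t| < 1`. -/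
def curveVelocity (X Y : Matrix n n ℂ) (t : ℝ) : Matrix n n ℂ :=
  ((-t / √(1 - t ^ 2) : ℝ) : ℂ) • X + Y

theorem hasDerivAt_sqrt_one_sub_sq {t : ℝ} (ht : 0 < 1 - t ^ 2) :
    HasDerivAt (fun s : ℝ => √(1 - s ^ 2)) (-t / √(1 - t ^ 2)) t := by
  have h := (((hasDerivAt_id t).pow 2).const_sub 1).sqrt ht.ne'
  refine h.congr_deriv ?_
  have : √(1 - t ^ 2) ≠ 0 := (Real.sqrt_pos.mpr ht).ne'
  simp only [id, Pi.pow_apply]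
  field_simp
  simp

theorem hasEntryDerivAt_curve (X Y : Matrix n n ℂ) {t : ℝ} (ht : 0 < 1 - t ^ 2) :
    HasEntryDerivAt (curve X Y) (curveVelocity X Y t) t := by
  have h := (HasEntryDerivAt.smul_const (hasDerivAt_sqrt_one_sub_sq ht) X).add
    (HasEntryDerivAt.smul_const (hasDerivAt_id t) Y)
  rw [Complex.ofReal_one, one_smul] at h
  exact h

theorem hasEntryDerivAt_curveVelocity (X Y : Matrix n n ℂ) :
    HasEntryDerivAt (curveVelocity X Y) (-X) 0 := by
  have h0 : (0 : ℝ) < 1 - 0 ^ 2 := by norm_num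
  have h1 : HasDerivAt (fun t : ℝ => -t / √(1 - t ^ 2)) (-1) 0 := by
    have := (hasDerivAt_id (0 : ℝ)).neg.div (hasDerivAt_sqrt_one_sub_sq h0)
      (Real.sqrt_pos.mpr h0).ne'
    refine this.congr_deriv ?_
    simp
  intro i j
  have := ((HasEntryDerivAt.smul_const h1 X) i j).add_const (Y i j)
  simpa [curveVelocity] using this

theorem curve_zero (X Y : Matrix n n ℂ) : curve X Y 0 = X := by
  simp [curve]

theorem curveVelocity_zero (X Y : Matrix n n ℂ) : curveVelocity X Y 0 = Y := by
  simp [curveVelocity]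

variable [Fintype n] [DecidableEq n]

theorem eventually_one_sub_sq_pos : ∀ᶠ t in 𝓝 (0 : ℝ), 0 < 1 - t ^ 2 := by
  have : ContinuousAt (fun t : ℝ => 1 - t ^ 2) 0 := by fun_prop
  exact this.eventually_const_lt (by norm_num)

/-- The curve passes through the invertible `X` at 0, and the determinant stays nonzero nearby. -/
theorem eventually_posDef_curve {X : Matrix n n ℂ} (hX : X.PosDef) (Y : Matrix n n ℂ) :
    ∀ᶠ t in 𝓝 (0 : ℝ), (curve X Y t * (curve X Y t)ᴴ).PosDef := by
  have hc : ContinuousAt (curve X Y) 0 := (hasEntryDerivAt_curve X Y (by norm_num)).continuousAt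
  have hdet : ContinuousAt (fun t => (curve X Y t).det) 0 :=
    ContinuousAt.comp (g := fun M : Matrix n n ℂ => M.det) (f := curve X Y)
      (continuous_id.matrix_det).continuousAt hc
  have h0 : (curve X Y 0).det ≠ 0 := by
    rw [curve_zero]
    exact ((Matrix.isUnit_iff_isUnit_det X).mp hX.isUnit).ne_zero
  filter_upwards [hdet.eventually_ne h0] with t ht
  refine Matrix.PosDef.mul_conjTranspose_self _ ?_
  exact Matrix.vecMul_injective_of_isUnit
    ((Matrix.isUnit_iff_isUnit_det _).mpr (isUnit_iff_ne_zero.mpr ht))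

theorem hasDerivAt_ofReal_curveEntropy {X : Matrix n n ℂ} (hX : X.PosDef) (Y : Matrix n n ℂ) :
    ∀ᶠ t in 𝓝 (0 : ℝ), HasDerivAt (fun s => (curveEntropy X Y s : ℂ))
      (-(((curveVelocity X Y t * (curve X Y t)ᴴ + curve X Y t * (curveVelocity X Y t)ᴴ) *
          matLog (curve X Y t * (curve X Y t)ᴴ)).trace +
        (curveVelocity X Y t * (curve X Y t)ᴴ + curve X Y t * (curveVelocity X Y t)ᴴ).trace))
      t := by
  filter_upwards [(eventually_posDef_curve hX Y).eventually_nhds, eventually_one_sub_sq_pos]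
    with t hpos ht
  have hc := hasEntryDerivAt_curve X Y ht
  exact hasDerivAt_ofReal_entropy (hc.mul hc.conjTranspose) hpos

theorem resolventIntegral_eq (X Y : Matrix n n ℂ) :
    resolventIntegral X Y = resolventSandwich (X ^ 2) (gammaOne X Y) (X ^ 2) := rfl

theorem hasDerivAt_ofReal_deriv_curveEntropy {X Y : Matrix n n ℂ} (hX : X.PosDef)
    (hnorm : (Y * Yᴴ).trace = (X * Xᴴ).trace) :
    HasDerivAt (fun s : ℝ => ((deriv (curveEntropy X Y) s : ℝ) : ℂ))
      (2 * (X ^ 2 * matLog (X ^ 2)).trace - 2 * (Y * Yᴴ * matLog (X ^ 2)).trace - Q X Y) 0 := by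
  have hc := hasEntryDerivAt_curve X Y (t := 0) (by norm_num)
  have hv := hasEntryDerivAt_curveVelocity X Y
  have hG := (hv.mul hc.conjTranspose).add (hc.mul hv.conjTranspose)
  have hL := hasEntryDerivAt_matLog (hc.mul hc.conjTranspose) (eventually_posDef_curve hX Y)
  have h := ((hG.mul hL).trace.add hG.trace).neg
  simp only [curve_zero, curveVelocity_zero, Matrix.conjTranspose_neg, hX.isHermitian.eq] at h
  refine (h.congr_of_eventuallyEq ?_).congr_deriv ?_
  · filter_upwards [hasDerivAt_ofReal_curveEntropy hX Y] with t ht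
    obtain ⟨h1, h2⟩ := hasDerivAt_re_and_ofReal_re ht
    rw [h1.deriv, h2]
    rfl
  -- The derivative of `ρ'` at 0 is 2YY† - 2X²; `hnorm` makes its trace vanish.
  · rw [hX.isHermitian.eq] at hnorm
    rw [Q, resolventIntegral_eq, gammaOne, pow_two]
    simp only [add_mul, neg_mul, mul_neg, Matrix.trace_add, Matrix.trace_neg, hnorm]
    ring

/-! ### Spectral evaluation of Q -/

theorem mul_conjTranspose_of_add_I_smul {W Z : Matrix n n ℂ} (hW : W.IsHermitian)
    (hZ : Z.IsHermitian) : (W + Complex.I • Z) * (W + Complex.I • Z)ᴴ =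
      W ^ 2 + Z ^ 2 - Complex.I • (W * Z - Z * W) := by
  rw [Matrix.conjTranspose_add, Matrix.conjTranspose_smul, hW.eq, hZ.eq]
  simp only [mul_add, add_mul, Matrix.mul_smul, Matrix.smul_mul, smul_smul, pow_two, smul_sub]
  simp
  abel

theorem phi_div_mul_sq {x y : ℝ} (hx : 0 < x) (hy : 0 < y) :
    phi (x / y) = logDivDiff (x ^ 2) (y ^ 2) * (x + y) ^ 2 := by
  by_cases h : x = y
  · subst h
    simp only [phi, logDivDiff, div_self hx.ne', if_true]
    field_simp
    norm_num
  · have h1 : x / y ≠ 1 := fun h1 => h ((div_eq_one_iff_eq hy.ne').mp h1)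
    have h2 : x ^ 2 ≠ y ^ 2 := fun h2 => h ((pow_left_inj₀ hx.le hy.le two_ne_zero).mp h2)
    have h3 : x - y ≠ 0 := sub_ne_zero.mpr h
    have h4 : x ^ 2 - y ^ 2 = (x - y) * (x + y) := by ring
    rw [phi, logDivDiff, if_neg h1, if_neg h2, div_pow, Real.log_div (by positivity)
      (by positivity), h4]
    have h5 : x / y - 1 = (x - y) / y := by field_simp
    rw [h5]
    field_simp

theorem phi_neg_div_mul_sq {x y : ℝ} (hx : 0 < x) (hy : 0 < y) :
    phi (-(x / y)) = logDivDiff (x ^ 2) (y ^ 2) * (x - y) ^ 2 := by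
  have h1 : -(x / y) ≠ 1 := by
    have : 0 < x / y := by positivity
    linarith
  rw [phi, if_neg h1, neg_sq, div_pow, Real.log_div (by positivity) (by positivity),
    ← sub_mul_logDivDiff]
  have h5 : -(x / y) - 1 = -((x + y) / y) := by field_simp; ring
  rw [h5]
  field_simp
  ring

/-- With Γ_ij = w_ij(x_i + x_j) + i z_ij(x_j - x_i), the product Γ_ij Γ_ji has a ww term with (x_i +
x_j)², a zz term with (x_i - x_j)², and the cross term i(x_i² - x_j²)(w_ij z_ji - z_ij w_ji).
Multiplied by L, these give φ(x_i/x_j), φ(-x_i/x_j) and log x_i² - log x_j². -/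
theorem Q_eq_traces {X W Z : Matrix n n ℂ} (hX : X.PosDef) (hW : W.IsHermitian)
    (hZ : Z.IsHermitian) :
    Q X (W + Complex.I • Z) =
      (W * superCfc phi (modularOp X) W).trace + (Z * superCfc phi (-modularOp X) Z).trace +
        2 * Complex.I * ((W * Z - Z * W) * matLog (X ^ 2)).trace := by
  have hd := IsDiagonalization.of_isHermitian hX.isHermitian
  set U : Matrix n n ℂ := (hX.isHermitian.eigenvectorUnitary : Matrix n n ℂ) with hU
  set x := hX.isHermitian.eigenvalues with hx
  have hpos : ∀ i, 0 < x i := hd.pos hX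
  have hWt := trace_mul_superCfc hd hpos phi 1 W
  have hZt := trace_mul_superCfc hd hpos phi (-1) Z
  simp only [Complex.ofReal_one, one_smul, one_mul] at hWt
  have hneg : ((-1 : ℝ) : ℂ) • modularOp X = -modularOp X := by
    rw [Complex.ofReal_neg, Complex.ofReal_one]
    exact neg_one_smul ℂ (modularOp X)
  rw [hneg] at hZt
  simp only [neg_mul, one_mul] at hZt
  rw [hWt, hZt, Q, resolventIntegral_eq, hd.sq.trace_mul_resolventSandwich
    (fun i => pow_pos (hpos i) 2)]
  set w := Uᴴ * W * U with hw
  set z := Uᴴ * Z * U with hz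
  have hΓ : Uᴴ * gammaOne X (W + Complex.I • Z) * U =
      Matrix.of fun i j => w i j * (x i + x j) + Complex.I * z i j * (x j - x i) := by
    have : Uᴴ * gammaOne X (W + Complex.I • Z) * U =
        (w + Complex.I • z) * Matrix.diagonal (fun i => (x i : ℂ)) +
          Matrix.diagonal (fun i => (x i : ℂ)) * (w - Complex.I • z) := by
      have hYt : (W + Complex.I • Z)ᴴ = W - Complex.I • Z := by
        rw [Matrix.conjTranspose_add, Matrix.conjTranspose_smul, hW.eq, hZ.eq]
        simp [sub_eq_add_neg]
      have h1 : w + Complex.I • z = Uᴴ * (W + Complex.I • Z) * U := by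
        simp only [hw, hz, mul_add, add_mul, Matrix.mul_smul, Matrix.smul_mul]
      have h2 : w - Complex.I • z = Uᴴ * (W - Complex.I • Z) * U := by
        simp only [hw, hz, mul_sub, sub_mul, Matrix.mul_smul, Matrix.smul_mul]
      rw [gammaOne, hYt, h1, h2, mul_add, add_mul, mul_assoc _ U, ← hd.mul_eq, ← mul_assoc _ _ U,
        ← mul_assoc (Matrix.diagonal _), ← mul_assoc (Matrix.diagonal _), ← hd.conj_mul_eq]
      simp only [mul_assoc]
    rw [this]
    ext i j
    rw [Matrix.add_apply, Matrix.mul_diagonal, Matrix.diagonal_mul, Matrix.of_apply]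
    simp only [Matrix.add_apply, Matrix.sub_apply, Matrix.smul_apply, smul_eq_mul]
    ring
  have hlog : ((W * Z - Z * W) * matLog (X ^ 2)).trace =
      ∑ i, ∑ j, (Real.log (x i ^ 2) : ℂ) * (w i j * z j i - z i j * w j i) := by
    have h1 : (w * z - z * w) = Uᴴ * (W * Z - Z * W) * U := by
      have : ∀ A B : Matrix n n ℂ, (Uᴴ * A * U) * (Uᴴ * B * U) = Uᴴ * (A * B) * U := by
        intro A B
        calc _ = Uᴴ * A * (U * Uᴴ) * B * U := by noncomm_ring
          _ = _ := by rw [hd.mul_conj]; noncomm_ring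
      rw [hw, hz, this, this, mul_sub, sub_mul]
    rw [matLog, (hd.sq.cfc Real.log).eq, ← mul_assoc, Matrix.trace_mul_comm, ← mul_assoc,
      ← mul_assoc, ← h1, Matrix.trace]
    refine Finset.sum_congr rfl fun i _ => ?_
    rw [Matrix.diag_apply, Matrix.mul_diagonal, Matrix.sub_apply, Matrix.mul_apply,
      Matrix.mul_apply, ← Finset.sum_sub_distrib, Finset.sum_mul]
    exact Finset.sum_congr rfl fun j _ => mul_comm _ _
  -- The bracket is antisymmetric in i and j; adding this relabelled form to `hlog` produces the
  -- difference of logarithms and uses up the factor 2.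
  have hlog' : ((W * Z - Z * W) * matLog (X ^ 2)).trace =
      ∑ i, ∑ j, -(Real.log (x j ^ 2) : ℂ) * (w i j * z j i - z i j * w j i) := by
    rw [hlog, Finset.sum_comm]
    exact Finset.sum_congr rfl fun j _ => Finset.sum_congr rfl fun i _ => by ring
  have htwo : 2 * Complex.I * ((W * Z - Z * W) * matLog (X ^ 2)).trace =
      ∑ i, ∑ j, Complex.I * (((x i ^ 2 - x j ^ 2) * logDivDiff (x i ^ 2) (x j ^ 2) : ℝ) : ℂ) *
        (w i j * z j i - z i j * w j i) := by
    rw [mul_comm 2 Complex.I, mul_assoc, two_mul]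
    nth_rewrite 1 [hlog]
    rw [hlog', ← Finset.sum_add_distrib, Finset.mul_sum]
    refine Finset.sum_congr rfl fun i _ => ?_
    rw [← Finset.sum_add_distrib, Finset.mul_sum]
    refine Finset.sum_congr rfl fun j _ => ?_
    rw [sub_mul_logDivDiff]
    push_cast
    ring
  rw [htwo, hΓ, ← Finset.sum_add_distrib, ← Finset.sum_add_distrib]
  refine Finset.sum_congr rfl fun i _ => ?_
  rw [← Finset.sum_add_distrib, ← Finset.sum_add_distrib]
  refine Finset.sum_congr rfl fun j _ => ?_
  rw [phi_div_mul_sq (hpos i) (hpos j), phi_neg_div_mul_sq (hpos i) (hpos j), Matrix.of_apply,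
    Matrix.of_apply]
  push_cast
  linear_combination (logDivDiff (x i ^ 2) (x j ^ 2) : ℂ) * (z i j * z j i) *
    (-(x i - x j : ℂ) ^ 2) * Complex.I_sq

theorem integrableOn_resolventIntegrand {X : Matrix n n ℂ} (hX : X.PosDef) (Y : Matrix n n ℂ)
    (i j : n) : IntegrableOn (fun u : ℝ => resolventIntegrand X Y u i j) (Ioi 0) := by
  have hd := IsDiagonalization.of_isHermitian hX.isHermitian
  have hpos := fun i => pow_pos (hd.pos hX i) 2
  exact hd.sq.integrableOn_resolvent_mul_mul_resolvent hpos hd.sq hpos (gammaOne X Y) i j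

end EntropyDeriv
end

theorem theorem5 {n : Type*} [Fintype n] [DecidableEq n] (X Y W Z : Matrix n n ℂ)
    (hX : X.PosDef) (hW : W.IsHermitian) (hZ : Z.IsHermitian) (hY : Y = W + Complex.I • Z)
    (hnorm : (Y * Yᴴ).trace = (X * Xᴴ).trace) :
    ((∀ᶠ t in nhds (0 : ℝ), DifferentiableAt ℝ (EntropyDeriv.curveEntropy X Y) t) ∧
      DifferentiableAt ℝ (deriv (EntropyDeriv.curveEntropy X Y)) 0) ∧
    (∀ i j, MeasureTheory.IntegrableOn
      (fun u : ℝ => EntropyDeriv.resolventIntegrand X Y u i j) (Set.Ioi 0)) ∧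
    ((EntropyDeriv.D2 X Y : ℝ) : ℂ) =
      -2 * ((EntropyDeriv.entropy (X ^ 2) : ℝ) : ℂ)
        - 2 * ((W ^ 2 + Z ^ 2) * EntropyDeriv.matLog (X ^ 2)).trace
        - EntropyDeriv.Qtilde X W Z ∧
    ((EntropyDeriv.D2 X Y : ℝ) : ℂ) =
      -2 * ((EntropyDeriv.entropy (X ^ 2) : ℝ) : ℂ)
        - 2 * ((W ^ 2 + Z ^ 2) * EntropyDeriv.matLog (X ^ 2)).trace
        - (W * EntropyDeriv.superCfc EntropyDeriv.phi (EntropyDeriv.modularOp X) W).trace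
        - (Z * EntropyDeriv.superCfc EntropyDeriv.phi (-EntropyDeriv.modularOp X) Z).trace := by
  obtain ⟨h1, h2⟩ := EntropyDeriv.hasDerivAt_re_and_ofReal_re
    (EntropyDeriv.hasDerivAt_ofReal_deriv_curveEntropy hX hnorm)
  have hD2 : ((EntropyDeriv.D2 X Y : ℝ) : ℂ) =
      -2 * ((EntropyDeriv.entropy (X ^ 2) : ℝ) : ℂ)
        - 2 * ((W ^ 2 + Z ^ 2) * EntropyDeriv.matLog (X ^ 2)).trace
        - EntropyDeriv.Qtilde X W Z := by
    -- YY† contributes W² + Z² and a commutator term -i(WZ - ZW); the latter is exactly what the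
    -- correction in `Qtilde` absorbs.
    rw [EntropyDeriv.D2, h1.deriv, h2, EntropyDeriv.ofReal_entropy (hX.isHermitian.pow 2), hY,
      EntropyDeriv.mul_conjTranspose_of_add_I_smul hW hZ, EntropyDeriv.Qtilde, sub_mul,
      Matrix.trace_sub, Matrix.smul_mul, Matrix.trace_smul, smul_eq_mul]
    ring
  refine ⟨⟨?_, h1.differentiableAt⟩,
    EntropyDeriv.integrableOn_resolventIntegrand hX Y, hD2, ?_⟩
  · filter_upwards [EntropyDeriv.hasDerivAt_ofReal_curveEntropy hX Y] with t ht
    exact (EntropyDeriv.hasDerivAt_re_and_ofReal_re ht).1.differentiableAt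
  · rw [hD2, EntropyDeriv.Qtilde, EntropyDeriv.Q_eq_traces hX hW hZ]
    ring
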